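/- Let $\mathcal H=\bigotimes_{r}\mathcal H^{(r)}$ be a finite-dimensional Hilbert space shared by finitely many parties $r$. A finite LOCC measurement on $\mathcal H$ is a POVM $(E_k)_{k}$ with finitely many outcomes that can be implemented by local operations and classical communication, with finite-dimensional local ancillas and a bounded number of rounds, where in each round one party performs a local quantum operation with finitely many outcomes (which may depend on all earlier outcomes) and communicates its outcome to all parties. For states $(\rho_\mu)$ and a priori probabilities $p_\mu>0$ with $\sum_\mu p_\mu=1$ let $$d_{\mathrm{mf}}(E)=1-\sum_k\max_\mu\, p_\mu\operatorname{tr}(\rho_\mu E_k)$$ be the minimal mean failure probability of $E$, and let $\hat d_{\mathrm{mf}}$ be the infimum of $d_{\mathrm{mf}}(E)$ over all finite LOCC measurements $E$. Proposition. Let $(|\psi_\mu\rangle)$ be a complete orthonormal basis of $\mathcal H$ consisting of product vectors $|\psi_\mu\rangle=\bigotimes_r|\omega_\mu^{(r)}\rangle$, and let $\rho_\mu=|\psi_\mu\rangle\langle\psi_\mu|$. If $\hat d_{\mathrm{mf}}=0$ for some a priori probabilities $p_\mu>0$, $\sum_\mu p_\mu=1$ (that is, if the basis can be discriminated perfectly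 by asymptotic LOCC), then there is a finite LOCC measurement that discriminates $(\rho_\mu)$ perfectly, i.e. one for which the index $\mu$ can be inferred with certainty from the outcome. -/

import Mathlib

open scoped Matrix ComplexOrder

noncomputable section

namespace LOCC

/-- The operator `⨂ r, A r`, in the product bases: its `(x, y)` entry is `∏ r, A r (x r) (y r)`.
The local operators may be rectangular.  The Hilbert space `⨂ r, ℂ^(κ r)` is represented as
`EuclideanSpace ℂ (∀ r, κ r)`. -/
def productOp {ι : Type*} [Fintype ι] {m n : ι → Type*}
    (A : ∀ r, Matrix (m r) (n r) ℂ) : Matrix (∀ r, m r) (∀ r, n r) ℂ :=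
  Matrix.of fun x y => ∏ r, A r (x r) (y r)

/-- A vector `⨂ r, ω r` of `⨂ r, ℂ^(κ r)`. -/
def IsProductVector {ι : Type*} [Fintype ι] {κ : ι → Type*}
    (v : EuclideanSpace ℂ (∀ r, κ r)) : Prop :=
  ∃ ω : ∀ r, κ r → ℂ, ∀ x, v x = ∏ r, ω r (x r)

/-- The operator `|v⟩⟨v|`. -/
def pureState {H : Type*} (v : EuclideanSpace ℂ H) : Matrix H H ℂ :=
  Matrix.vecMulVec v.ofLp (star v.ofLp)

/-- A measurement with `n` outcomes: a positive operator valued measure on `ℂ^H`. -/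
structure POVM (H : Type*) [Fintype H] [DecidableEq H] (n : ℕ) where
  effect : Fin n → Matrix H H ℂ
  posSemidef : ∀ k, (effect k).PosSemidef
  sum_eq_one : ∑ k, effect k = 1

/-- The probability `tr (ρ E_k)` of outcome `k` in the state `ρ`. -/
def POVM.prob {H : Type*} [Fintype H] [DecidableEq H] {n : ℕ} (E : POVM H n)
    (ρ : Matrix H H ℂ) (k : Fin n) : ℝ :=
  (Matrix.trace (ρ * E.effect k)).re

/-- The operator on `⨂ s, ℂ^(σ s)` acting as `K` on party `r` and as the identity elsewhere. -/
def localOp {ι : Type*} [Fintype ι] [DecidableEq ι] {σ : ι → Type*} [∀ r, DecidableEq (σ r)]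
    (r : ι) (K : Matrix (σ r) (σ r) ℂ) : Matrix (∀ s, σ s) (∀ s, σ s) ℂ :=
  productOp (Function.update (fun s => (1 : Matrix (σ s) (σ s) ℂ)) r K)

/-- A finite LOCC protocol of parties `r : ι` with local spaces `ℂ^(σ r)`, as a finite tree.
Either the protocol stops and announces a result `ω`, or some party `r` performs a local quantum
operation with finitely many outcomes `k`, given by Kraus operators `K k` with
`∑ k, (K k)ᴴ * K k = 1`, everybody is told `k`, and the protocol goes on with `next k`.
Being an inductive type with finite branching, each protocol has a bounded number of rounds. -/
inductive Protocol {ι : Type*} (σ : ι → Type*)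
    [∀ r, Fintype (σ r)] [∀ r, DecidableEq (σ r)] (Ω : Type)
  | output (ω : Ω) : Protocol σ Ω
  | measure (r : ι) (n : ℕ) (K : Fin n → Matrix (σ r) (σ r) ℂ)
      (hK : ∑ k, (K k)ᴴ * K k = 1) (next : Fin n → Protocol σ Ω) : Protocol σ Ω

/-- The effect of the announced result `ω`: the sum of `A_Bᴴ * A_B` over the branches `B` of the
tree which end in `ω`, where `A_B` is the product of the (local) Kraus operators along `B`, the
first operation standing on the right. -/
def Protocol.effect {ι : Type*} [Fintype ι] [DecidableEq ι] {σ : ι → Type*}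
    [∀ r, Fintype (σ r)] [∀ r, DecidableEq (σ r)] {Ω : Type} [DecidableEq Ω] :
    Protocol σ Ω → Ω → Matrix (∀ r, σ r) (∀ r, σ r) ℂ
  | .output ω', ω => if ω' = ω then 1 else 0
  | .measure r _ K _ next, ω =>
      ∑ k, (localOp r (K k))ᴴ * (next k).effect ω * localOp r (K k)

/-- The isometry `v ↦ v ⊗ |0⟩` with which each party `r` adjoins an ancilla `ℂ^(a r + 1)` in a
fixed pure state. -/
def adjoinAncilla {ι : Type*} [Fintype ι] (κ : ι → Type*) [∀ r, DecidableEq (κ r)] (a : ι → ℕ) :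
    Matrix (∀ r, κ r × Fin (a r + 1)) (∀ r, κ r) ℂ :=
  productOp fun r => Matrix.of fun (x : κ r × Fin (a r + 1)) (y : κ r) =>
    if x = (y, 0) then 1 else 0

/-- `E` is a finite LOCC measurement: it is implemented by a finite LOCC protocol in which the
parties may use local ancillas of finite dimension. -/
def IsFiniteLOCC {ι : Type*} [Fintype ι] [DecidableEq ι] {κ : ι → Type*}
    [∀ r, Fintype (κ r)] [∀ r, DecidableEq (κ r)] {n : ℕ} (E : POVM (∀ r, κ r) n) : Prop :=
  ∃ (a : ι → ℕ) (P : Protocol (fun r => κ r × Fin (a r + 1)) (Fin n)),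
    ∀ k, E.effect k = (adjoinAncilla κ a)ᴴ * P.effect k * adjoinAncilla κ a

/-- `E` discriminates the states `ρ μ` perfectly: the index `μ` can be inferred with certainty
from the outcome. -/
def PerfectlyDiscriminates {H : Type*} [Fintype H] [DecidableEq H] {M : Type*} {n : ℕ}
    (E : POVM H n) (ρ : M → Matrix H H ℂ) : Prop :=
  ∃ guess : Fin n → M, ∀ k μ, μ ≠ guess k → E.prob (ρ μ) k = 0

/-- The minimal mean failure probability
`d_mf(E) = 1 - ∑ k, max_μ (p μ * tr (ρ μ E_k))`. -/
def dmf {H : Type*} [Fintype H] [DecidableEq H] {M : Type*} {n : ℕ}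
    (p : M → ℝ) (ρ : M → Matrix H H ℂ) (E : POVM H n) : ℝ :=
  1 - ∑ k, ⨆ μ, p μ * E.prob (ρ μ) k

/-- The asymptotic deviation: the infimum of `d_mf` over all finite LOCC measurements. -/
def asymptoticDmf {ι : Type*} [Fintype ι] [DecidableEq ι] {κ : ι → Type*}
    [∀ r, Fintype (κ r)] [∀ r, DecidableEq (κ r)] {M : Type*}
    (p : M → ℝ) (ρ : M → Matrix (∀ r, κ r) (∀ r, κ r) ℂ) : ℝ :=
  sInf {x : ℝ | ∃ (n : ℕ) (E : POVM (∀ r, κ r) n), IsFiniteLOCC E ∧ x = dmf p ρ E}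

end LOCC

end

/-! Let `S` be a set of at least two basis vectors still to be told apart. Run a protocol of small
error on the span of `S`. In the basis, the operator `Aᴴ * A` of a branch starts as the indicator of
`S`, whose largest diagonal entry is `1/|S|` of the trace; at the end of a good branch one entry
carries almost all of it. So some measurement step passes a prescribed ratio `χ` strictly between
`1/|S|` and 1 (`exists_crossing`). The step changes only one tensor factor, so interpolating
linearly in that factor gives a product operator with ratio exactly `χ`. Small error makes it nearly
diagonal, because the operators before and after the step are sums of effects that each nearly
single out one index (`norm_sum_apply_le`).

As the error tends to 0, compactness of tuples of density operators gives a product `⨂ F r` that is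
exactly diagonal in the basis, supported on `S`, with largest entry `χ`
(`exists_diagonal_productEffects_of_discriminable`). For `1/|S| < χ < 1/(|S| - 1)` the entries on
`S` are all nonzero and not all equal. Nonzero eigenvalues make each local vector an eigenvector of
`F r`; unequal ones make some `F r` have different eigenvalues on `S`. A spectral projection of that
`F r` splits `S` properly and disturbs none of its vectors (`exists_localProjection`). Recursion on
`|S|` builds a finite perfect protocol. -/

set_option linter.unusedSectionVars false

noncomputable section

namespace LOCC

open Function

/-! ### Algebra of product operators -/

section ProductOperators

variable {ι : Type*} [Fintype ι]

/-- The vector `⨂ r, ω r`. -/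
def productVec {κ : ι → Type*} (ω : ∀ r, κ r → ℂ) : (∀ r, κ r) → ℂ :=
  fun x => ∏ r, ω r (x r)

theorem productOp_conjTranspose {m n : ι → Type*} (A : ∀ r, Matrix (m r) (n r) ℂ) :
    (productOp A)ᴴ = productOp fun r => (A r)ᴴ := by
  ext x y
  simp [productOp, Matrix.conjTranspose_apply]

theorem productOp_one {n : ι → Type*} [∀ r, DecidableEq (n r)] :
    productOp (fun r => (1 : Matrix (n r) (n r) ℂ)) = 1 := by
  ext x y
  by_cases h : x = y
  · subst h; simp [productOp]
  · obtain ⟨r, hr⟩ := Function.ne_iff.mp h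
    rw [Matrix.one_apply_ne h]
    exact Finset.prod_eq_zero (Finset.mem_univ r) (Matrix.one_apply_ne hr)

theorem productOp_smul {m n : ι → Type*} (c : ι → ℂ) (A : ∀ r, Matrix (m r) (n r) ℂ) :
    productOp (fun r => c r • A r) = (∏ r, c r) • productOp A := by
  ext x y
  simp [productOp, Finset.prod_mul_distrib]

theorem continuous_productOp {m n : ι → Type*} :
    Continuous (productOp : (∀ r, Matrix (m r) (n r) ℂ) → _) := by
  refine continuous_matrix fun x y => ?_
  simp only [productOp, Matrix.of_apply]
  exact continuous_finsetProd _ fun r _ => (continuous_apply r).matrix_elem (x r) (y r)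

/-- The local isometry `v ↦ v ⊗ |0⟩`. -/
def ancillaOp (α : Type*) [DecidableEq α] (a : ℕ) : Matrix (α × Fin (a + 1)) α ℂ :=
  Matrix.of fun x y => if x = (y, 0) then 1 else 0

theorem adjoinAncilla_eq (κ : ι → Type*) [∀ r, DecidableEq (κ r)] (a : ι → ℕ) :
    adjoinAncilla κ a = productOp fun r => ancillaOp (κ r) (a r) := rfl

variable [DecidableEq ι]

theorem productOp_mul {l m n : ι → Type*} [∀ r, Fintype (m r)]
    (A : ∀ r, Matrix (l r) (m r) ℂ) (B : ∀ r, Matrix (m r) (n r) ℂ) :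
    productOp A * productOp B = productOp fun r => A r * B r := by
  ext x y
  simp only [productOp, Matrix.mul_apply, Matrix.of_apply, ← Finset.prod_mul_distrib]
  rw [Finset.prod_univ_sum, Fintype.piFinset_univ]

theorem productOp_mulVec {m n : ι → Type*} [∀ r, Fintype (n r)]
    (A : ∀ r, Matrix (m r) (n r) ℂ) (ω : ∀ r, n r → ℂ) :
    productOp A *ᵥ productVec ω = productVec fun r => A r *ᵥ ω r := by
  ext x
  simp only [productOp, productVec, Matrix.mulVec, dotProduct, Matrix.of_apply,
    ← Finset.prod_mul_distrib]
  rw [Finset.prod_univ_sum, Fintype.piFinset_univ]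

theorem trace_productOp {n : ι → Type*} [∀ r, Fintype (n r)] (A : ∀ r, Matrix (n r) (n r) ℂ) :
    (productOp A).trace = ∏ r, (A r).trace := by
  simp only [productOp, Matrix.trace, Matrix.diag_apply, Matrix.of_apply]
  rw [Finset.prod_univ_sum, Fintype.piFinset_univ]

theorem productOp_update_apply {m n : ι → Type*} (A : ∀ r, Matrix (m r) (n r) ℂ) (r : ι)
    (X : Matrix (m r) (n r) ℂ) (x : ∀ r, m r) (y : ∀ r, n r) :
    productOp (update A r X) x y
      = X (x r) (y r) * ∏ s ∈ Finset.univ.erase r, A s (x s) (y s) := by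
  rw [productOp, Matrix.of_apply, ← Finset.mul_prod_erase _ _ (Finset.mem_univ r), update_self]
  congr 1
  refine Finset.prod_congr rfl fun s hs => ?_
  rw [update_of_ne (Finset.ne_of_mem_erase hs)]

/-- Linearity in a single slot is what keeps the interpolation between two successive branch
operators inside the set of product operators. -/
theorem productOp_update_add_smul {m n : ι → Type*} (A : ∀ r, Matrix (m r) (n r) ℂ) (r : ι)
    (a b : ℂ) (X Y : Matrix (m r) (n r) ℂ) :
    productOp (update A r (a • X + b • Y))
      = a • productOp (update A r X) + b • productOp (update A r Y) := by
  ext x y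
  simp only [productOp_update_apply, Matrix.add_apply, Matrix.smul_apply, smul_eq_mul]
  ring

theorem localOp_mul_productOp {σ n : ι → Type*} [∀ r, Fintype (σ r)] [∀ r, DecidableEq (σ r)]
    (r : ι) (K : Matrix (σ r) (σ r) ℂ) (A : ∀ r, Matrix (σ r) (n r) ℂ) :
    localOp r K * productOp A = productOp (update A r (K * A r)) := by
  rw [localOp, productOp_mul]
  congr 1
  ext1 s
  by_cases h : s = r
  · subst h; simp
  · simp [h]

theorem localOp_mulVec {σ : ι → Type*} [∀ r, Fintype (σ r)] [∀ r, DecidableEq (σ r)]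
    (r : ι) (K : Matrix (σ r) (σ r) ℂ) (ω : ∀ r, σ r → ℂ) :
    localOp r K *ᵥ productVec ω = productVec (update ω r (K *ᵥ ω r)) := by
  rw [localOp, productOp_mulVec]
  congr 1
  ext1 s
  by_cases h : s = r
  · subst h; simp
  · simp [h]

theorem localOp_mul_localOp {σ : ι → Type*} [∀ r, Fintype (σ r)] [∀ r, DecidableEq (σ r)]
    (r : ι) (K L : Matrix (σ r) (σ r) ℂ) : localOp r K * localOp r L = localOp r (K * L) := by
  rw [localOp.eq_def r L, localOp_mul_productOp]
  simp [localOp]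

theorem localOp_conjTranspose {σ : ι → Type*} [∀ r, DecidableEq (σ r)]
    (r : ι) (K : Matrix (σ r) (σ r) ℂ) : (localOp r K)ᴴ = localOp r Kᴴ := by
  rw [localOp, localOp, productOp_conjTranspose]
  congr 1
  ext1 s
  by_cases h : s = r
  · subst h; simp
  · simp [h]

theorem localOp_one {σ : ι → Type*} [∀ r, DecidableEq (σ r)] (r : ι) :
    localOp r (1 : Matrix (σ r) (σ r) ℂ) = 1 := by
  rw [localOp, update_eq_self_iff.mpr rfl, productOp_one]

theorem sum_localOp {σ : ι → Type*} [∀ r, DecidableEq (σ r)] {α : Type*} [Fintype α]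
    (r : ι) (K : α → Matrix (σ r) (σ r) ℂ) :
    ∑ k, localOp r (K k) = localOp r (∑ k, K k) := by
  ext x y
  simp only [localOp, Matrix.sum_apply, productOp_update_apply, Finset.sum_mul]

end ProductOperators

/-! ### Protocols implement measurements -/

section Protocols

variable {ι : Type*} [Fintype ι] [DecidableEq ι] {σ : ι → Type*}
  [∀ r, Fintype (σ r)] [∀ r, DecidableEq (σ r)] {Ω : Type} [DecidableEq Ω]

theorem sum_localOp_conjTranspose_mul_self {r : ι} {n : ℕ} {K : Fin n → Matrix (σ r) (σ r) ℂ}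
    (hK : ∑ k, (K k)ᴴ * K k = 1) : ∑ k, (localOp r (K k))ᴴ * localOp r (K k) = 1 := by
  simp only [localOp_conjTranspose, localOp_mul_localOp]
  rw [sum_localOp, hK, localOp_one]

theorem Protocol.effect_posSemidef (P : Protocol σ Ω) (ω : Ω) : (P.effect ω).PosSemidef := by
  induction P with
  | output ω' =>
    rw [Protocol.effect]
    split_ifs
    · exact Matrix.PosSemidef.one
    · exact Matrix.PosSemidef.zero
  | measure r n K hK next ih =>
    rw [Protocol.effect]
    exact Matrix.posSemidef_sum _ fun k _ => (ih k).conjTranspose_mul_mul_same _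

theorem Protocol.sum_effect [Fintype Ω] (P : Protocol σ Ω) : ∑ ω, P.effect ω = 1 := by
  induction P with
  | output ω' => simp [Protocol.effect]
  | measure r n K hK next ih =>
    simp only [Protocol.effect]
    rw [Finset.sum_comm, ← sum_localOp_conjTranspose_mul_self hK]
    refine Finset.sum_congr rfl fun k _ => ?_
    rw [← Finset.sum_mul, ← Finset.mul_sum, ih, mul_one]

theorem ancillaOp_conjTranspose_mul_self (α : Type*) [Fintype α] [DecidableEq α] (a : ℕ) :
    (ancillaOp α a)ᴴ * ancillaOp α a = 1 := by
  ext x y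
  simp only [ancillaOp, Matrix.mul_apply, Matrix.conjTranspose_apply, Matrix.of_apply,
    Matrix.one_apply]
  rw [Finset.sum_eq_single (x, 0)]
  · simp
  · intro b _ hb; simp [hb]
  · simp

theorem adjoinAncilla_conjTranspose_mul_self (κ : ι → Type*) [∀ r, Fintype (κ r)]
    [∀ r, DecidableEq (κ r)] (a : ι → ℕ) : (adjoinAncilla κ a)ᴴ * adjoinAncilla κ a = 1 := by
  simp only [adjoinAncilla_eq, productOp_conjTranspose, productOp_mul,
    ancillaOp_conjTranspose_mul_self, productOp_one]

/-- The measurement implemented by a protocol with ancillas. -/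
def Protocol.toPOVM {κ : ι → Type*} [∀ r, Fintype (κ r)] [∀ r, DecidableEq (κ r)] {a : ι → ℕ}
    {n : ℕ} (P : Protocol (fun r => κ r × Fin (a r + 1)) (Fin n)) : POVM (∀ r, κ r) n where
  effect k := (adjoinAncilla κ a)ᴴ * P.effect k * adjoinAncilla κ a
  posSemidef k := (P.effect_posSemidef k).conjTranspose_mul_mul_same _
  sum_eq_one := by
    rw [← Matrix.sum_mul, ← Matrix.mul_sum, P.sum_effect, Matrix.mul_one,
      adjoinAncilla_conjTranspose_mul_self]

theorem Protocol.isFiniteLOCC_toPOVM {κ : ι → Type*} [∀ r, Fintype (κ r)]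
    [∀ r, DecidableEq (κ r)] {a : ι → ℕ} {n : ℕ}
    (P : Protocol (fun r => κ r × Fin (a r + 1)) (Fin n)) : IsFiniteLOCC P.toPOVM :=
  ⟨a, P, fun _ => rfl⟩

end Protocols

/-! ### Branch operators and the crossing step -/

section Branches

/-- The `2 × 2` principal minor on `μ, ν` is nonnegative. -/
theorem norm_apply_le_sqrt_mul_sqrt {M : Type*} [Fintype M] [DecidableEq M] {G : Matrix M M ℂ}
    (hG : G.PosSemidef) (μ ν : M) : ‖G μ ν‖ ≤ √(G μ μ).re * √(G ν ν).re := by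
  have hdiag : ∀ μ, G μ μ = ((G μ μ).re : ℂ) := fun μ =>
    (Complex.conj_eq_iff_re.mp (hG.isHermitian.apply μ μ)).symm
  have h0 : ∀ μ, 0 ≤ (G μ μ).re := fun μ => (Complex.le_def.mp hG.diag_nonneg).1
  have hdet := (hG.submatrix ![μ, ν]).det_nonneg
  rw [Matrix.det_fin_two] at hdet
  simp only [Matrix.submatrix_apply, Matrix.cons_val_zero, Matrix.cons_val_one] at hdet
  rw [← hG.isHermitian.apply ν μ, hdiag μ, hdiag ν] at hdet
  have : (G μ ν) * star (G μ ν) = ((‖G μ ν‖ ^ 2 : ℝ) : ℂ) := by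
    rw [Complex.star_def, Complex.mul_conj, Complex.normSq_eq_norm_sq]
  rw [this, ← Complex.ofReal_mul, ← Complex.ofReal_sub, Complex.zero_le_real] at hdet
  rw [← Real.sqrt_mul (h0 μ)]
  exact Real.le_sqrt_of_sq_le (by linarith)

variable {ι : Type*} [Fintype ι] [DecidableEq ι] {κ σ : ι → Type*}
  [∀ r, Fintype (κ r)] [∀ r, Fintype (σ r)] [∀ r, DecidableEq (σ r)] {Ω : Type} [DecidableEq Ω]
  [Fintype Ω] {M : Type*} [Fintype M] [DecidableEq M]

/-- The operator `Aᴴ * A` for `A = ⨂ r, A r`, in the basis given by the columns of `U`. -/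
def branchGram (U : Matrix (∀ r, κ r) M ℂ) (A : ∀ r, Matrix (σ r) (κ r) ℂ) : Matrix M M ℂ :=
  (productOp A * U)ᴴ * (productOp A * U)

/-- The effect of the result `ω`, if `P` is performed after the local operators `A r`, in the basis
given by the columns of `U`. -/
def branchEffect (U : Matrix (∀ r, κ r) M ℂ) (A : ∀ r, Matrix (σ r) (κ r) ℂ)
    (P : Protocol σ Ω) (ω : Ω) : Matrix M M ℂ :=
  (productOp A * U)ᴴ * P.effect ω * (productOp A * U)

/-- The total weight of the wrong guesses when `g ω` is inferred from the effect `G ω`. -/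
def errorWeight (g : Ω → M) (G : Ω → Matrix M M ℂ) : ℝ :=
  ∑ ω, ∑ μ ∈ Finset.univ.erase (g ω), (G ω μ μ).re

/-- The operator `e` is diagonal up to `ε`, relative to its trace, and is supported on `S`. -/
def NearlyDiagonal (S : Finset M) (ε : ℝ) (e : Matrix M M ℂ) : Prop :=
  0 < e.trace.re ∧ (∀ μ ∉ S, e μ μ = 0) ∧ ∀ μ ν, μ ≠ ν → ‖e μ ν‖ ≤ ε * e.trace.re

theorem branchGram_posSemidef (U : Matrix (∀ r, κ r) M ℂ) (A : ∀ r, Matrix (σ r) (κ r) ℂ) :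
    (branchGram U A).PosSemidef :=
  Matrix.posSemidef_conjTranspose_mul_self _

theorem branchEffect_posSemidef (U : Matrix (∀ r, κ r) M ℂ) (A : ∀ r, Matrix (σ r) (κ r) ℂ)
    (P : Protocol σ Ω) (ω : Ω) : (branchEffect U A P ω).PosSemidef :=
  (P.effect_posSemidef ω).conjTranspose_mul_mul_same _

theorem sum_branchEffect (U : Matrix (∀ r, κ r) M ℂ) (A : ∀ r, Matrix (σ r) (κ r) ℂ)
    (P : Protocol σ Ω) : ∑ ω, branchEffect U A P ω = branchGram U A := by
  simp only [branchEffect, branchGram]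
  rw [← Matrix.sum_mul, ← Matrix.mul_sum, P.sum_effect, Matrix.mul_one]

/-- Absorbing the first Kraus operator into the factor `A r` lets inductions over the tree run with
`A` generalized. -/
theorem branchEffect_measure (U : Matrix (∀ r, κ r) M ℂ) (A : ∀ r, Matrix (σ r) (κ r) ℂ)
    (r : ι) (n : ℕ) (K : Fin n → Matrix (σ r) (σ r) ℂ) (hK : ∑ k, (K k)ᴴ * K k = 1)
    (next : Fin n → Protocol σ Ω) (ω : Ω) :
    branchEffect U A (.measure r n K hK next) ω
      = ∑ k, branchEffect U (update A r (K k * A r)) (next k) ω := by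
  simp only [branchEffect, Protocol.effect, Matrix.mul_sum, Matrix.sum_mul,
    ← localOp_mul_productOp, Matrix.conjTranspose_mul, Matrix.mul_assoc]

theorem branchGram_eq_sum (U : Matrix (∀ r, κ r) M ℂ) (A : ∀ r, Matrix (σ r) (κ r) ℂ)
    {r : ι} {n : ℕ} {K : Fin n → Matrix (σ r) (σ r) ℂ} (hK : ∑ k, (K k)ᴴ * K k = 1) :
    branchGram U A = ∑ k, branchGram U (update A r (K k * A r)) := by
  have h := sum_localOp_conjTranspose_mul_self hK
  calc branchGram U A
      = (productOp A * U)ᴴ * (∑ k, (localOp r (K k))ᴴ * localOp r (K k)) * (productOp A * U) := by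
        rw [h, Matrix.mul_one, branchGram]
    _ = _ := by
        simp only [branchGram, Matrix.mul_sum, Matrix.sum_mul, ← localOp_mul_productOp,
          Matrix.conjTranspose_mul, Matrix.mul_assoc]

theorem errorWeight_nonneg (g : Ω → M) {G : Ω → Matrix M M ℂ} (hG : ∀ ω, (G ω).PosSemidef) :
    0 ≤ errorWeight g G :=
  Finset.sum_nonneg fun ω _ => Finset.sum_nonneg fun _ _ =>
    (Complex.le_def.mp (hG ω).diag_nonneg).1

/-- If `g` infers the index with small error, then `∑ ω, G ω` is close to a diagonal operator. -/
theorem norm_sum_apply_le (g : Ω → M) {G : Ω → Matrix M M ℂ} (hG : ∀ ω, (G ω).PosSemidef)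
    {μ ν : M} (hμν : μ ≠ ν) :
    ‖(∑ ω, G ω) μ ν‖ ≤ √(errorWeight g G) * √(∑ ω, G ω).trace.re := by
  have h0 : ∀ ω μ, 0 ≤ (G ω μ μ).re := fun ω μ => (Complex.le_def.mp (hG ω).diag_nonneg).1
  have hw : ∀ ω μ, (G ω μ μ).re ≤ (G ω).trace.re := fun ω μ => by
    rw [Matrix.trace, Complex.re_sum]
    exact Finset.single_le_sum (f := fun μ => ((G ω).diag μ).re) (fun μ _ => h0 ω μ)
      (Finset.mem_univ μ)
  have hf : ∀ ω μ, μ ≠ g ω → (G ω μ μ).re ≤ ∑ μ ∈ Finset.univ.erase (g ω), (G ω μ μ).re :=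
    fun ω μ h => Finset.single_le_sum (f := fun μ => (G ω μ μ).re) (fun μ _ => h0 ω μ)
      (Finset.mem_erase.mpr ⟨h, Finset.mem_univ μ⟩)
  rw [Matrix.sum_apply, Matrix.trace_sum, Complex.re_sum, errorWeight]
  refine (norm_sum_le _ _).trans (le_trans (Finset.sum_le_sum fun ω _ => ?_)
    (Real.sum_sqrt_mul_sqrt_le _ (fun ω => Finset.sum_nonneg fun μ _ => h0 ω μ)
      (fun ω => (h0 ω μ).trans (hw ω μ))))
  refine (norm_apply_le_sqrt_mul_sqrt (hG ω) μ ν).trans ?_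
  by_cases h : μ = g ω
  -- At most one of `μ, ν` is the guess `g ω`, so one of the two diagonal entries counts as error
  -- and the other is bounded by the trace.
  · rw [mul_comm]
    exact mul_le_mul (Real.sqrt_le_sqrt (hf ω ν (h ▸ hμν.symm))) (Real.sqrt_le_sqrt (hw ω μ))
      (Real.sqrt_nonneg _) (Real.sqrt_nonneg _)
  · exact mul_le_mul (Real.sqrt_le_sqrt (hf ω μ h)) (Real.sqrt_le_sqrt (hw ω ν))
      (Real.sqrt_nonneg _) (Real.sqrt_nonneg _)

/-- A relative error below `η` bounds off-diagonal entries by `√(ηw) * √w = √η * w`, with `w` the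
trace. Strictness of the error bound also forces `w > 0`. -/
theorem nearlyDiagonal_branchGram (U : Matrix (∀ r, κ r) M ℂ) (A : ∀ r, Matrix (σ r) (κ r) ℂ)
    (P : Protocol σ Ω) (g : Ω → M) (S : Finset M) {η : ℝ} (hη : 0 ≤ η)
    (hS : ∀ μ ∉ S, branchGram U A μ μ = 0)
    (h : errorWeight g (branchEffect U A P) < η * (branchGram U A).trace.re) :
    NearlyDiagonal S (√η) (branchGram U A) := by
  have hpos := branchEffect_posSemidef U A P
  have hw : 0 < (branchGram U A).trace.re :=
    pos_of_mul_pos_right ((errorWeight_nonneg g hpos).trans_lt h) hη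
  refine ⟨hw, hS, fun μ ν hμν => ?_⟩
  have key := norm_sum_apply_le g hpos hμν
  rw [sum_branchEffect] at key
  refine key.trans ?_
  calc _ ≤ √(η * (branchGram U A).trace.re) * √(branchGram U A).trace.re := by
        gcongr
    _ = _ := by rw [Real.sqrt_mul hη, mul_assoc, Real.mul_self_sqrt hw.le]

/-- In a protocol with a small error there is a measurement step, close to diagonal before and
after the step, at which the largest diagonal entry exceeds `χ` times the trace for the first
time. -/
theorem exists_crossing (U : Matrix (∀ r, κ r) M ℂ) (g : Ω → M) (S : Finset M) {χ η : ℝ}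
    (hη : 0 ≤ η) (hηχ : η ≤ 1 - χ) (P : Protocol σ Ω) (A : ∀ r, Matrix (σ r) (κ r) ℂ)
    (hA : ∀ μ, (branchGram U A μ μ).re ≤ χ * (branchGram U A).trace.re)
    (hS : ∀ μ ∉ S, branchGram U A μ μ = 0)
    (hP : errorWeight g (branchEffect U A P) < η * (branchGram U A).trace.re) :
    ∃ (B : ∀ r, Matrix (σ r) (κ r) ℂ) (r : ι) (K : Matrix (σ r) (σ r) ℂ),
      (∀ μ, (branchGram U B μ μ).re ≤ χ * (branchGram U B).trace.re) ∧
      NearlyDiagonal S (√η) (branchGram U B) ∧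
      (∃ μ, χ * (branchGram U (update B r (K * B r))).trace.re
        < (branchGram U (update B r (K * B r)) μ μ).re) ∧
      NearlyDiagonal S (√η) (branchGram U (update B r (K * B r))) := by
  induction P generalizing A with
  | output ω' =>
    exfalso
    -- Stopping here would leave an error of at least `(1 - χ)` times the trace, hence at least `η`
    -- times it.
    have herr : errorWeight g (branchEffect U A (.output ω'))
        = (branchGram U A).trace.re - (branchGram U A (g ω') (g ω')).re := by
      rw [errorWeight, Finset.sum_eq_single ω']
      · rw [Matrix.trace, Complex.re_sum, ← Finset.add_sum_erase _ _ (Finset.mem_univ (g ω'))]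
        simp [branchEffect, branchGram, Protocol.effect]
      · intro ω _ hω
        simp [branchEffect, Protocol.effect, hω.symm]
      · simp
    have hw : 0 ≤ (branchGram U A).trace.re :=
      (Complex.le_def.mp (branchGram_posSemidef U A).trace_nonneg).1
    have := hA (g ω')
    nlinarith [mul_le_mul_of_nonneg_right hηχ hw]
  | measure r n K hK next ih =>
    have hgram := branchGram_eq_sum U A hK
    have hpos : ∀ k μ, 0 ≤ branchGram U (update A r (K k * A r)) μ μ := fun k μ =>
      (branchGram_posSemidef U _).diag_nonneg
    have hSk : ∀ k, ∀ μ ∉ S, branchGram U (update A r (K k * A r)) μ μ = 0 := by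
      intro k μ hμ
      have h := hS μ hμ
      rw [hgram, Matrix.sum_apply, Finset.sum_eq_zero_iff_of_nonneg fun k _ => hpos k μ] at h
      exact h k (Finset.mem_univ k)
    -- Error and trace both add up over the outcomes, so some outcome has relative error below `η`.
    obtain ⟨k, hk⟩ : ∃ k, errorWeight g (branchEffect U (update A r (K k * A r)) (next k))
        < η * (branchGram U (update A r (K k * A r))).trace.re := by
      by_contra! hcon
      have h1 := Finset.sum_le_sum fun k (_ : k ∈ Finset.univ) => hcon k
      have h2 : errorWeight g (branchEffect U A (.measure r n K hK next))
          = ∑ k, errorWeight g (branchEffect U (update A r (K k * A r)) (next k)) := by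
        simp only [errorWeight, branchEffect_measure, Matrix.sum_apply, Complex.re_sum]
        rw [Finset.sum_comm]
        refine Finset.sum_congr rfl fun ω _ => ?_
        rw [Finset.sum_comm]
      rw [← h2, ← Finset.mul_sum, ← Complex.re_sum, ← Matrix.trace_sum, ← hgram] at h1
      exact absurd hP (not_lt.mpr h1)
    by_cases hk' : ∀ μ, (branchGram U (update A r (K k * A r)) μ μ).re
        ≤ χ * (branchGram U (update A r (K k * A r))).trace.re
    · exact ih k _ hk' (hSk k) hk
    · push Not at hk'
      exact ⟨A, r, K k, hA, nearlyDiagonal_branchGram U A _ g S hη hS hP, hk',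
        nearlyDiagonal_branchGram U _ _ g S hη (hSk k) hk⟩

end Branches

/-! ### Interpolation to an exact ratio -/

section Interpolation

/-- Intermediate value theorem for the maximum over `μ` of the affine functions of `t`. -/
theorem exists_convexCombination_eq_zero {M : Type*} [Finite M] (a b : M → ℝ)
    (ha : ∀ μ, a μ ≤ 0) (hb : ∃ μ, 0 < b μ) :
    ∃ t ∈ Set.Icc (0 : ℝ) 1, (∀ μ, (1 - t) * a μ + t * b μ ≤ 0) ∧
      ∃ μ, (1 - t) * a μ + t * b μ = 0 := by
  have := Fintype.ofFinite M
  obtain ⟨μ₀, hμ₀⟩ := hb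
  have hne : (Finset.univ : Finset M).Nonempty := ⟨μ₀, Finset.mem_univ _⟩
  let h : ℝ → ℝ := fun t => Finset.univ.sup' hne fun μ => (1 - t) * a μ + t * b μ
  have hcont : Continuous h := Continuous.finset_sup'_apply hne fun μ _ => by fun_prop
  have h0 : h 0 ≤ 0 := Finset.sup'_le _ _ fun μ _ => by simpa using ha μ
  have h1 : 0 ≤ h 1 := by
    refine le_trans ?_ (Finset.le_sup' (fun μ => (1 - (1 : ℝ)) * a μ + 1 * b μ)
      (Finset.mem_univ μ₀))
    simpa using hμ₀.le
  obtain ⟨t, ht, hht⟩ := intermediate_value_Icc zero_le_one hcont.continuousOn ⟨h0, h1⟩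
  refine ⟨t, ht, fun μ => ?_, ?_⟩
  · rw [← hht]
    exact Finset.le_sup' (fun μ => (1 - t) * a μ + t * b μ) (Finset.mem_univ μ)
  · obtain ⟨μ, -, hμ⟩ := Finset.exists_mem_eq_sup' hne fun μ => (1 - t) * a μ + t * b μ
    exact ⟨μ, hμ ▸ hht⟩

variable {M : Type*} [Fintype M] [DecidableEq M]

theorem NearlyDiagonal.convexCombination {S : Finset M} {ε : ℝ} {d e : Matrix M M ℂ}
    (hd : NearlyDiagonal S ε d) (he : NearlyDiagonal S ε e) {t : ℝ} (ht : t ∈ Set.Icc (0 : ℝ) 1) :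
    NearlyDiagonal S ε (((1 - t : ℝ) : ℂ) • d + (t : ℂ) • e) := by
  have h1 : 0 ≤ 1 - t := sub_nonneg.mpr ht.2
  have htr : (((1 - t : ℝ) : ℂ) • d + (t : ℂ) • e).trace.re
      = (1 - t) * d.trace.re + t * e.trace.re := by
    rw [Matrix.trace_add, Matrix.trace_smul, Matrix.trace_smul, Complex.add_re, smul_eq_mul,
      smul_eq_mul, Complex.re_ofReal_mul, Complex.re_ofReal_mul]
  refine ⟨?_, fun μ hμ => ?_, fun μ ν hμν => ?_⟩
  · rw [htr]
    rcases eq_or_lt_of_le ht.1 with h | h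
    · rw [← h]; simpa using hd.1
    · have := mul_nonneg h1 hd.1.le
      have := mul_pos h he.1
      linarith
  · simp [hd.2.1 μ hμ, he.2.1 μ hμ]
  · rw [htr, Matrix.add_apply, Matrix.smul_apply, Matrix.smul_apply]
    refine (norm_add_le _ _).trans ?_
    rw [norm_smul, norm_smul, Complex.norm_of_nonneg h1, Complex.norm_of_nonneg ht.1]
    have := mul_le_mul_of_nonneg_left (hd.2.2 μ ν hμν) h1
    have := mul_le_mul_of_nonneg_left (he.2.2 μ ν hμν) ht.1
    linarith

end Interpolation

/-! ### Products of density operators and compactness -/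

section ProductEffects

variable {ι : Type*} [Fintype ι] [DecidableEq ι] {κ σ : ι → Type*}
  [∀ r, Fintype (κ r)] [∀ r, Fintype (σ r)] [∀ r, DecidableEq (σ r)]
  {M : Type*} [Fintype M] [DecidableEq M]

/-- The product operator `⨂ r, F r` in the basis given by the columns of `U`. -/
def inBasis (U : Matrix (∀ r, κ r) M ℂ) (F : ∀ r, Matrix (κ r) (κ r) ℂ) : Matrix M M ℂ :=
  Uᴴ * productOp F * U

/-- The tuples of density operators `F r` for which `⨂ r, F r` is supported on `S` and has the
largest diagonal entry `χ`, in the basis given by the columns of `U`. -/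
def productEffects (U : Matrix (∀ r, κ r) M ℂ) (S : Finset M) (χ : ℝ) :
    Set (∀ r, Matrix (κ r) (κ r) ℂ) :=
  {F | (∀ r, (F r).PosSemidef ∧ (F r).trace = 1) ∧ (∀ μ ∉ S, inBasis U F μ μ = 0) ∧
    (∀ μ, (inBasis U F μ μ).re ≤ χ) ∧ ∃ μ, (inBasis U F μ μ).re = χ}

theorem branchGram_eq_inBasis (U : Matrix (∀ r, κ r) M ℂ) (A : ∀ r, Matrix (σ r) (κ r) ℂ) :
    branchGram U A = inBasis U fun r => (A r)ᴴ * A r := by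
  rw [branchGram, inBasis, ← productOp_mul, ← productOp_conjTranspose, Matrix.conjTranspose_mul]
  simp only [Matrix.mul_assoc]

theorem trace_inBasis [∀ r, DecidableEq (κ r)] {U : Matrix (∀ r, κ r) M ℂ} (hU : U * Uᴴ = 1)
    (F : ∀ r, Matrix (κ r) (κ r) ℂ) : (inBasis U F).trace = ∏ r, (F r).trace := by
  rw [inBasis, Matrix.mul_assoc, Matrix.trace_mul_comm, Matrix.mul_assoc, hU, Matrix.mul_one,
    trace_productOp]

theorem inBasis_smul (U : Matrix (∀ r, κ r) M ℂ) (c : ι → ℂ) (F : ∀ r, Matrix (κ r) (κ r) ℂ) :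
    inBasis U (fun r => c r • F r) = (∏ r, c r) • inBasis U F := by
  rw [inBasis, inBasis, productOp_smul, Matrix.mul_smul, Matrix.smul_mul]

/-- Each factor is divided by its trace. The traces multiply to the trace of the whole operator,
which is positive, so none of them vanishes; all conditions are homogeneous. -/
theorem exists_productEffects_of_nearlyDiagonal [∀ r, DecidableEq (κ r)]
    {U : Matrix (∀ r, κ r) M ℂ} (hU : U * Uᴴ = 1) {S : Finset M} {χ ε : ℝ}
    {B : ∀ r, Matrix (κ r) (κ r) ℂ} (hB : ∀ r, (B r).PosSemidef)
    (hχ : ∀ μ, (inBasis U B μ μ).re ≤ χ * (inBasis U B).trace.re)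
    (hχ' : ∃ μ, (inBasis U B μ μ).re = χ * (inBasis U B).trace.re)
    (h : NearlyDiagonal S ε (inBasis U B)) :
    ∃ F ∈ productEffects U S χ, ∀ μ ν, μ ≠ ν → ‖inBasis U F μ ν‖ ≤ ε := by
  obtain ⟨hw, hS, hoff⟩ := h
  set w := (inBasis U B).trace.re with hwdef
  have hre : ∀ r, (B r).trace = ((B r).trace.re : ℂ) := fun r =>
    Complex.ext rfl (Complex.nonneg_iff.mp (hB r).trace_nonneg).2.symm
  have hprod : (inBasis U B).trace = (w : ℂ) := by
    rw [hwdef, trace_inBasis hU, Finset.prod_congr rfl fun r _ => hre r, ← Complex.ofReal_prod,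
      Complex.ofReal_re]
  have hprod' := hprod
  rw [trace_inBasis hU] at hprod'
  have hwC : (w : ℂ) ≠ 0 := Complex.ofReal_ne_zero.mpr hw.ne'
  have htr : ∀ r, (B r).trace ≠ 0 := fun r =>
    Finset.prod_ne_zero_iff.mp (hprod' ▸ hwC) r (Finset.mem_univ r)
  have hF : inBasis U (fun r => (B r).trace⁻¹ • B r) = ((w⁻¹ : ℝ) : ℂ) • inBasis U B := by
    rw [inBasis_smul, Finset.prod_inv_distrib, hprod', Complex.ofReal_inv]
  have hentry : ∀ μ, (inBasis U (fun r => (B r).trace⁻¹ • B r) μ μ).re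
      = w⁻¹ * (inBasis U B μ μ).re := fun μ => by
    rw [hF, Matrix.smul_apply, smul_eq_mul, Complex.re_ofReal_mul]
  refine ⟨fun r => (B r).trace⁻¹ • B r, ⟨fun r => ⟨?_, ?_⟩, fun μ hμ => ?_, fun μ => ?_, ?_⟩, ?_⟩
  · exact (hB r).smul (inv_nonneg_of_nonneg (hB r).trace_nonneg)
  · rw [Matrix.trace_smul, smul_eq_mul, inv_mul_cancel₀ (htr r)]
  · rw [hF, Matrix.smul_apply, hS μ hμ, smul_zero]
  · rw [hentry, inv_mul_le_iff₀ hw, mul_comm]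
    exact hχ μ
  · obtain ⟨μ, hμ⟩ := hχ'
    exact ⟨μ, by rw [hentry, hμ, mul_comm χ, inv_mul_cancel_left₀ hw.ne']⟩
  · intro μ ν hμν
    rw [hF, Matrix.smul_apply, norm_smul, Complex.norm_of_nonneg (inv_nonneg.mpr hw.le),
      inv_mul_le_iff₀ hw, mul_comm]
    exact hoff μ ν hμν

/-- A protocol with small error provides a product operator with the largest diagonal entry `χ`
that is close to diagonal. -/
theorem exists_productEffects_of_errorWeight_lt [∀ r, DecidableEq (κ r)]
    {U : Matrix (∀ r, κ r) M ℂ} (hU : U * Uᴴ = 1)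
    {Ω : Type} [DecidableEq Ω] [Fintype Ω] (g : Ω → M) {S : Finset M} {χ η : ℝ}
    (hη : 0 ≤ η) (hηχ : η ≤ 1 - χ) (P : Protocol σ Ω) (A : ∀ r, Matrix (σ r) (κ r) ℂ)
    (hA : ∀ μ, (branchGram U A μ μ).re ≤ χ * (branchGram U A).trace.re)
    (hS : ∀ μ ∉ S, branchGram U A μ μ = 0)
    (hP : errorWeight g (branchEffect U A P) < η * (branchGram U A).trace.re) :
    ∃ F ∈ productEffects U S χ, ∀ μ ν, μ ≠ ν → ‖inBasis U F μ ν‖ ≤ √η := by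
  obtain ⟨B, r, K, hB, hdB, hC, hdC⟩ := exists_crossing U g S hη hηχ P A hA hS hP
  have hgram0 := branchGram_eq_inBasis U B
  have hgram1 := branchGram_eq_inBasis U (update B r (K * B r))
  set D : ∀ r, Matrix (κ r) (κ r) ℂ := fun r => (B r)ᴴ * B r with hD
  set X : Matrix (κ r) (κ r) ℂ := (K * B r)ᴴ * (K * B r) with hX
  have hupd : (fun s => (update B r (K * B r) s)ᴴ * update B r (K * B r) s) = update D r X := by
    ext1 s
    by_cases h : s = r
    · subst h; simp [hX]
    · simp [h, hD]
  rw [hupd] at hgram1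
  rw [hgram0] at hB hdB
  rw [hgram1] at hC hdC
  obtain ⟨t, ht, hle, hex⟩ := exists_convexCombination_eq_zero
    (fun μ => (inBasis U D μ μ).re - χ * (inBasis U D).trace.re)
    (fun μ => (inBasis U (update D r X) μ μ).re - χ * (inBasis U (update D r X)).trace.re)
    (fun μ => sub_nonpos.mpr (hB μ)) (hC.imp fun μ => sub_pos.mpr)
  -- The operators before and after the step differ only in slot `r`, so their convex combination is
  -- again a product, with `Y` in that slot.
  set Y : Matrix (κ r) (κ r) ℂ := ((1 - t : ℝ) : ℂ) • D r + (t : ℂ) • X with hY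
  have hbasis : inBasis U (update D r Y)
      = ((1 - t : ℝ) : ℂ) • inBasis U D + (t : ℂ) • inBasis U (update D r X) := by
    rw [inBasis, hY, productOp_update_add_smul, update_eq_self, Matrix.mul_add, Matrix.add_mul,
      Matrix.mul_smul, Matrix.smul_mul, Matrix.mul_smul, Matrix.smul_mul, inBasis, inBasis]
  have hval : ∀ μ, (inBasis U (update D r Y) μ μ).re
        - χ * (inBasis U (update D r Y)).trace.re
      = (1 - t) * ((inBasis U D μ μ).re - χ * (inBasis U D).trace.re)
        + t * ((inBasis U (update D r X) μ μ).re
          - χ * (inBasis U (update D r X)).trace.re) := fun μ => by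
    rw [hbasis, Matrix.trace_add, Matrix.trace_smul, Matrix.trace_smul, Matrix.add_apply,
      Matrix.smul_apply, Matrix.smul_apply]
    simp only [smul_eq_mul, Complex.add_re, Complex.re_ofReal_mul]
    ring
  refine exists_productEffects_of_nearlyDiagonal (B := update D r Y) hU (fun s => ?_)
    (fun μ => ?_) ?_ (hbasis ▸ hdB.convexCombination hdC ht)
  · by_cases h : s = r
    · subst h
      rw [update_self]
      refine Matrix.PosSemidef.add ?_ ?_
      · exact (Matrix.posSemidef_conjTranspose_mul_self _).smul
          (Complex.zero_le_real.mpr (sub_nonneg.mpr ht.2))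
      · exact (Matrix.posSemidef_conjTranspose_mul_self _).smul (Complex.zero_le_real.mpr ht.1)
    · rw [update_of_ne h]
      exact Matrix.posSemidef_conjTranspose_mul_self _
  · have := hle μ
    rw [← hval] at this
    linarith
  · obtain ⟨μ, hμ⟩ := hex
    rw [← hval] at hμ
    exact ⟨μ, by linarith⟩

theorem isCompact_setOf_posSemidef_trace_eq_one (n : Type*) [Fintype n] :
    IsCompact {X : Matrix n n ℂ | X.PosSemidef ∧ X.trace = 1} := by
  classical
  have hbox : IsCompact (Set.univ.pi fun _ : n => Set.univ.pi fun _ : n =>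
      Metric.closedBall (0 : ℂ) 1) :=
    isCompact_univ_pi fun _ => isCompact_univ_pi fun _ => isCompact_closedBall 0 1
  refine IsCompact.of_isClosed_subset (X := Matrix n n ℂ) hbox ?_ fun X hX i _ j _ => ?_
  · simp only [Matrix.posSemidef_iff_dotProduct_mulVec, Set.ofPred_and, Set.ofPred_forall]
    refine ((isClosed_eq (by fun_prop) continuous_id).inter
      (isClosed_iInter fun x => isClosed_le continuous_const (by fun_prop))).inter
      (isClosed_eq (by fun_prop) continuous_const)
  · rw [mem_closedBall_zero_iff]
    have h0 : ∀ i, 0 ≤ (X i i).re := fun i => (Complex.le_def.mp hX.1.diag_nonneg).1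
    have h1 : ∀ i, (X i i).re ≤ 1 := fun i => by
      have := congrArg Complex.re hX.2
      rw [Matrix.trace, Complex.re_sum, Complex.one_re] at this
      rw [← this]
      exact Finset.single_le_sum (f := fun i => (X.diag i).re) (fun i _ => h0 i)
        (Finset.mem_univ i)
    refine (norm_apply_le_sqrt_mul_sqrt hX.1 i j).trans ?_
    exact mul_le_one₀ (Real.sqrt_le_one.mpr (h1 i)) (Real.sqrt_nonneg _)
      (Real.sqrt_le_one.mpr (h1 j))

theorem continuous_inBasis_apply (U : Matrix (∀ r, κ r) M ℂ) (μ ν : M) :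
    Continuous fun F : ∀ r, Matrix (κ r) (κ r) ℂ => inBasis U F μ ν :=
  ((continuous_const.matrix_mul continuous_productOp).matrix_mul continuous_const).matrix_elem μ ν

theorem isCompact_productEffects (U : Matrix (∀ r, κ r) M ℂ) (S : Finset M) (χ : ℝ) :
    IsCompact (productEffects U S χ) := by
  have hbox : IsCompact (Set.univ.pi fun r =>
      {X : Matrix (κ r) (κ r) ℂ | X.PosSemidef ∧ X.trace = 1}) :=
    isCompact_univ_pi fun r => isCompact_setOf_posSemidef_trace_eq_one (κ r)
  have hcont := continuous_inBasis_apply (κ := κ) U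
  have hclosed : IsClosed {F : ∀ r, Matrix (κ r) (κ r) ℂ | (∀ μ ∉ S, inBasis U F μ μ = 0) ∧
      (∀ μ, (inBasis U F μ μ).re ≤ χ) ∧ ∃ μ, (inBasis U F μ μ).re = χ} := by
    simp only [Set.ofPred_and, Set.ofPred_forall, Set.ofPred_exists]
    refine IsClosed.inter ?_ (IsClosed.inter ?_ ?_)
    · exact isClosed_iInter fun μ => isClosed_iInter fun _ =>
        isClosed_eq (hcont μ μ) continuous_const
    · exact isClosed_iInter fun μ =>
        isClosed_le (Complex.continuous_re.comp (hcont μ μ)) continuous_const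
    · exact isClosed_iUnion_of_finite fun μ =>
        isClosed_eq (Complex.continuous_re.comp (hcont μ μ)) continuous_const
  convert hbox.inter_right hclosed using 1
  ext F
  simp [productEffects, Set.mem_pi]

theorem exists_apply_nonpos_of_isCompact {X : Type*} [TopologicalSpace X] {C : Set X}
    (hC : IsCompact C) {f : X → ℝ} (hf : Continuous f) (h : ∀ ε > 0, ∃ x ∈ C, f x ≤ ε) :
    ∃ x ∈ C, f x ≤ 0 := by
  obtain ⟨x₁, hx₁, -⟩ := h 1 one_pos
  obtain ⟨x, hx, hmin⟩ := hC.exists_isMinOn ⟨x₁, hx₁⟩ hf.continuousOn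
  refine ⟨x, hx, le_of_forall_pos_le_add fun ε hε => ?_⟩
  obtain ⟨y, hy, hyε⟩ := h ε hε
  rw [zero_add]
  exact (isMinOn_iff.mp hmin y hy).trans hyε

/-- The sum of the off-diagonal norms attains its minimum on a compact set, and that minimum is
below every positive number. -/
theorem exists_productEffects_diagonal {U : Matrix (∀ r, κ r) M ℂ} {S : Finset M} {χ : ℝ}
    (h : ∀ ε > (0 : ℝ), ∃ F ∈ productEffects U S χ, ∀ μ ν, μ ≠ ν → ‖inBasis U F μ ν‖ ≤ ε) :
    ∃ F ∈ productEffects U S χ, ∀ μ ν, μ ≠ ν → inBasis U F μ ν = 0 := by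
  obtain ⟨F, hF, hle⟩ := exists_apply_nonpos_of_isCompact (isCompact_productEffects U S χ)
    (continuous_finsetSum (Finset.univ : Finset M).offDiag fun q _ =>
      (continuous_inBasis_apply U q.1 q.2).norm) fun δ hδ => by
    -- The `+ 1` keeps the denominator positive when there are no off-diagonal pairs.
    obtain ⟨F, hF, hsmall⟩ := h (δ / ((Finset.univ : Finset M).offDiag.card + 1)) (by positivity)
    refine ⟨F, hF, (Finset.sum_le_card_nsmul _ _ _ fun q hq =>
      hsmall q.1 q.2 (Finset.mem_offDiag.mp hq).2.2).trans ?_⟩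
    rw [nsmul_eq_mul, mul_div_assoc', div_le_iff₀ (by positivity), mul_comm]
    exact mul_le_mul_of_nonneg_left (by linarith) hδ.le
  rw [(Finset.sum_nonneg fun q _ => norm_nonneg (inBasis U F q.1 q.2)).ge_iff_eq'] at hle
  rw [Finset.sum_eq_zero_iff_of_nonneg fun q _ => norm_nonneg _] at hle
  exact ⟨F, hF, fun μ ν hμν => norm_eq_zero.mp
    (hle (μ, ν) (Finset.mem_offDiag.mpr ⟨Finset.mem_univ μ, Finset.mem_univ ν, hμν⟩))⟩

end ProductEffects

/-! ### Local eigenvectors and projective measurements -/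

section Eigenvectors

/-- This is the orthogonal projection onto the eigenspace of `z`; eigenvectors for other eigenvalues
of a Hermitian matrix are orthogonal to it. -/
theorem exists_spectralProjection {n : Type*} [Fintype n] [DecidableEq n] {X : Matrix n n ℂ}
    (hX : X.IsHermitian) (z : ℂ) :
    ∃ p : Matrix n n ℂ, pᴴ = p ∧ p * p = p ∧
      ∀ (c : ℂ) (v : n → ℂ), X *ᵥ v = c • v → p *ᵥ v = if c = z then v else 0 := by
  classical
  set W : Matrix n n ℂ := (hX.eigenvectorUnitary : Matrix n n ℂ) with hW
  have h1 : Wᴴ * W = 1 := Unitary.coe_star_mul_self hX.eigenvectorUnitary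
  have h2 : W * Wᴴ = 1 := Unitary.coe_mul_star_self hX.eigenvectorUnitary
  set d : n → ℂ := fun i => (hX.eigenvalues i : ℂ) with hd
  have hspec : X = W * Matrix.diagonal d * Wᴴ := by
    conv_lhs => rw [hX.spectral_theorem]
    rfl
  set χ : n → ℂ := fun i => if d i = z then 1 else 0 with hχ
  refine ⟨W * Matrix.diagonal χ * Wᴴ, ?_, ?_, fun c v hv => ?_⟩
  · have : star χ = χ := by
      ext i; simp only [hχ, Pi.star_apply]; split_ifs <;> simp
    rw [Matrix.conjTranspose_mul, Matrix.conjTranspose_mul, Matrix.conjTranspose_conjTranspose,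
      Matrix.diagonal_conjTranspose, this, Matrix.mul_assoc]
  · have : Matrix.diagonal χ * Matrix.diagonal χ = Matrix.diagonal χ := by
      rw [Matrix.diagonal_mul_diagonal]
      congr 1; ext i; simp only [hχ]; split_ifs <;> simp
    calc _ = W * (Matrix.diagonal χ * (Wᴴ * W) * Matrix.diagonal χ) * Wᴴ := by
          simp only [Matrix.mul_assoc]
      _ = _ := by rw [h1, Matrix.mul_one, this]
  · have hu : Matrix.diagonal d *ᵥ (Wᴴ *ᵥ v) = c • (Wᴴ *ᵥ v) := by
      rw [← Matrix.mulVec_smul, ← hv, hspec, Matrix.mulVec_mulVec, Matrix.mulVec_mulVec,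
        ← Matrix.mul_assoc, ← Matrix.mul_assoc, h1, Matrix.one_mul]
    have hu' : Matrix.diagonal χ *ᵥ (Wᴴ *ᵥ v) = (if c = z then (1 : ℂ) else 0) • (Wᴴ *ᵥ v) := by
      ext i
      have hi := congrFun hu i
      rw [Matrix.mulVec_diagonal, Pi.smul_apply, smul_eq_mul] at hi
      rw [Matrix.mulVec_diagonal, Pi.smul_apply, smul_eq_mul]
      by_cases h0 : (Wᴴ *ᵥ v) i = 0
      · rw [h0, mul_zero, mul_zero]
      · have : d i = c := mul_right_cancel₀ h0 hi
        simp only [hχ, this]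
    rw [Matrix.mul_assoc, ← Matrix.mulVec_mulVec, ← Matrix.mulVec_mulVec, hu', Matrix.mulVec_smul,
      Matrix.mulVec_mulVec, h2, Matrix.one_mulVec]
    split_ifs <;> simp

variable {ι : Type*} [Fintype ι] [DecidableEq ι] {κ : ι → Type*}

theorem productVec_update_apply (ω : ∀ r, κ r → ℂ) (r : ι) (v : κ r → ℂ) (x : ∀ r, κ r) :
    productVec (update ω r v) x = v (x r) * ∏ s ∈ Finset.univ.erase r, ω s (x s) := by
  rw [productVec, ← Finset.mul_prod_erase _ _ (Finset.mem_univ r), update_self]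
  congr 1
  refine Finset.prod_congr rfl fun s hs => ?_
  rw [update_of_ne (Finset.ne_of_mem_erase hs)]

/-- The factors of a nonzero product vector are determined up to scalars. -/
theorem exists_eq_smul_of_productVec_eq_smul {η ω : ∀ r, κ r → ℂ} {e : ℂ} (he : e ≠ 0)
    (hω : productVec ω ≠ 0) (h : productVec η = e • productVec ω) :
    ∃ c : ι → ℂ, (∀ r, η r = c r • ω r) ∧ ∏ r, c r = e := by
  obtain ⟨x, hx⟩ := Function.ne_iff.mp hω
  have hηx : productVec η x ≠ 0 := by
    rw [h]; exact mul_ne_zero he hx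
  have hη0 : ∀ s, η s (x s) ≠ 0 := fun s => Finset.prod_ne_zero_iff.mp hηx s (Finset.mem_univ s)
  have hω0 : ∀ s, ω s (x s) ≠ 0 := fun s => Finset.prod_ne_zero_iff.mp hx s (Finset.mem_univ s)
  refine ⟨fun r => η r (x r) / ω r (x r), fun r => ?_, ?_⟩
  -- Varying only coordinate `r` of the base point `x` isolates the factor `η r`; comparing with the
  -- value at `x r` then eliminates `e`.
  · have key : ∀ y, η r y * ∏ s ∈ Finset.univ.erase r, η s (x s)
        = e * (ω r y * ∏ s ∈ Finset.univ.erase r, ω s (x s)) := fun y => by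
      have hy := congrFun h (update x r y)
      have hcongr : ∀ θ : ∀ r, κ r → ℂ, productVec θ (update x r y)
          = θ r y * ∏ s ∈ Finset.univ.erase r, θ s (x s) := fun θ => by
        rw [productVec, ← Finset.mul_prod_erase _ _ (Finset.mem_univ r), update_self]
        congr 1
        refine Finset.prod_congr rfl fun s hs => ?_
        rw [update_of_ne (Finset.ne_of_mem_erase hs)]
      rwa [Pi.smul_apply, smul_eq_mul, hcongr, hcongr] at hy
    have hR : ∏ s ∈ Finset.univ.erase r, η s (x s) ≠ 0 :=
      Finset.prod_ne_zero_iff.mpr fun s _ => hη0 s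
    ext y
    rw [Pi.smul_apply, smul_eq_mul, div_mul_eq_mul_div, eq_div_iff (hω0 r)]
    refine mul_right_cancel₀ hR ?_
    linear_combination ω r (x r) * key y - ω r y * key (x r)
  · rw [Finset.prod_div_distrib, div_eq_iff (show ∏ r, ω r (x r) ≠ 0 from hx)]
    exact congrFun h x

variable [∀ r, Fintype (κ r)] [∀ r, DecidableEq (κ r)]

theorem localOp_mulVec_eq_self {r : ι} {K : Matrix (κ r) (κ r) ℂ} {ω : ∀ r, κ r → ℂ}
    (h : K *ᵥ ω r = ω r) : localOp r K *ᵥ productVec ω = productVec ω := by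
  rw [localOp_mulVec, h, update_eq_self]

theorem localOp_mulVec_eq_zero {r : ι} {K : Matrix (κ r) (κ r) ℂ} {ω : ∀ r, κ r → ℂ}
    (h : K *ᵥ ω r = 0) : localOp r K *ᵥ productVec ω = 0 := by
  ext x
  rw [localOp_mulVec, h, productVec_update_apply, Pi.zero_apply, zero_mul, Pi.zero_apply]

variable {σ : ι → Type*} [∀ r, Fintype (σ r)] [∀ r, DecidableEq (σ r)]

theorem localOp_mul_productOp_comm {V : ∀ r, Matrix (σ r) (κ r) ℂ} {r : ι}
    {L : Matrix (σ r) (σ r) ℂ} {K : Matrix (κ r) (κ r) ℂ} (h : L * V r = V r * K) :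
    localOp r L * productOp V = productOp V * localOp r K := by
  rw [localOp_mul_productOp, h, localOp, productOp_mul]
  congr 1
  ext1 s
  by_cases hs : s = r
  · subst hs; simp
  · simp [hs]

/-- A projective measurement of a subspace, embedded by the isometry `V r`, extends to a
measurement of the whole local space. -/
theorem exists_twoOutcomeMeasurement {V : ∀ r, Matrix (σ r) (κ r) ℂ} {r : ι}
    (hV : (V r)ᴴ * V r = 1) {p : Matrix (κ r) (κ r) ℂ} (hp : pᴴ = p) (hpp : p * p = p) :
    ∃ K : Fin 2 → Matrix (σ r) (σ r) ℂ, ∑ k, (K k)ᴴ * K k = 1 ∧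
      localOp r (K 0) * productOp V = productOp V * localOp r p ∧
      localOp r (K 1) * productOp V = productOp V * localOp r (1 - p) := by
  set L := V r * p * (V r)ᴴ with hL
  have hLh : Lᴴ = L := by
    rw [hL, Matrix.conjTranspose_mul, Matrix.conjTranspose_mul, Matrix.conjTranspose_conjTranspose,
      hp, Matrix.mul_assoc]
  have hLV : L * V r = V r * p := by rw [hL, Matrix.mul_assoc, hV, Matrix.mul_one]
  have hLL : L * L = L := by
    calc L * L = L * V r * p * (V r)ᴴ := by simp only [hL, Matrix.mul_assoc]
      _ = L := by rw [hLV, Matrix.mul_assoc (V r), hpp]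
  -- The second outcome is `1 - L`, not `V r * (1 - p) * (V r)ᴴ`, so that the measurement is
  -- complete outside the range of `V r` as well.
  refine ⟨![L, 1 - L], ?_, localOp_mul_productOp_comm hLV, localOp_mul_productOp_comm ?_⟩
  · simp only [Fin.sum_univ_two, Matrix.cons_val_zero, Matrix.cons_val_one,
      Matrix.conjTranspose_sub, Matrix.conjTranspose_one, hLh]
    rw [Matrix.sub_mul, Matrix.one_mul, Matrix.mul_sub, Matrix.mul_one, hLL]
    abel
  · change (1 - L) * V r = _
    rw [Matrix.sub_mul, Matrix.one_mul, hLV, Matrix.mul_sub, Matrix.mul_one]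

end Eigenvectors

/-! ### Splitting the basis and building the protocol -/

section Discrimination

variable {ι : Type*} [Fintype ι] [DecidableEq ι] {κ : ι → Type*}
  [∀ r, Fintype (κ r)] [∀ r, DecidableEq (κ r)] {M : Type*} [Fintype M] [DecidableEq M]

/-- The orthonormal basis with the columns of `U` can be discriminated by finite protocols with an
arbitrarily small error. -/
def AsymptoticallyDiscriminable (U : Matrix (∀ r, κ r) M ℂ) : Prop :=
  ∀ ε > 0, ∃ (a : ι → ℕ) (n : ℕ) (P : Protocol (fun r => κ r × Fin (a r + 1)) (Fin n))
    (g : Fin n → M), errorWeight g (branchEffect U (fun r => ancillaOp (κ r) (a r)) P) < ε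

/-- The operator `Q` starts the approximating protocols from the span of `S`, where all entries are
equal and the initial ratio is `1/|S| ≤ χ`. Ancillas vary with the protocol, but the resulting
tuples `F` live on the fixed spaces `κ r`, so a limit exists. -/
theorem exists_diagonal_productEffects_of_discriminable {U : Matrix (∀ r, κ r) M ℂ}
    (hU : U * Uᴴ = 1) (hU' : Uᴴ * U = 1) (hdisc : AsymptoticallyDiscriminable U)
    {S : Finset M} (hne : S.Nonempty) {Q : ∀ r, Matrix (κ r) (κ r) ℂ}
    (hQ : productOp Q * U = U * Matrix.diagonal fun μ => if μ ∈ S then (1 : ℂ) else 0)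
    {χ : ℝ} (hχ : 1 ≤ χ * S.card) (hχ' : χ < 1) :
    ∃ F ∈ productEffects U S χ, ∀ μ ν, μ ≠ ν → inBasis U F μ ν = 0 := by
  set d : M → ℂ := fun μ => if μ ∈ S then (1 : ℂ) else 0 with hd
  refine exists_productEffects_diagonal fun ε hε => ?_
  -- `ε ^ 2` gives off-diagonal entries at most `ε`; `1 - χ` forces the crossing.
  have hη : 0 < min (ε ^ 2) (1 - χ) := lt_min (by positivity) (by linarith)
  obtain ⟨a, n, P, g, hP⟩ := hdisc _ hη
  set V : ∀ r, Matrix (κ r × Fin (a r + 1)) (κ r) ℂ := fun r => ancillaOp (κ r) (a r) with hV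
  have hVV : (productOp V)ᴴ * productOp V = 1 := adjoinAncilla_conjTranspose_mul_self κ a
  have hds : (Matrix.diagonal d)ᴴ = Matrix.diagonal d := by
    rw [Matrix.diagonal_conjTranspose]
    congr 1; ext μ; simp only [hd, Pi.star_apply]; split_ifs <;> simp
  have hA : productOp (fun r => V r * Q r) * U = productOp V * U * Matrix.diagonal d := by
    rw [← productOp_mul, Matrix.mul_assoc, hQ, Matrix.mul_assoc]
  have hgram : branchGram U (fun r => V r * Q r) = Matrix.diagonal d := by
    rw [branchGram, hA, Matrix.conjTranspose_mul, Matrix.conjTranspose_mul, hds]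
    calc _ = Matrix.diagonal d * (Uᴴ * ((productOp V)ᴴ * productOp V) * U) * Matrix.diagonal d := by
          simp only [Matrix.mul_assoc]
      _ = _ := by
          rw [hVV, Matrix.mul_one, hU', Matrix.mul_one, Matrix.diagonal_mul_diagonal]
          congr 1; ext μ; simp only [hd]; split_ifs <;> simp
  have htr : (branchGram U fun r => V r * Q r).trace.re = S.card := by
    rw [hgram, Matrix.trace_diagonal]; simp [hd]
  have hcard : (1 : ℝ) ≤ S.card := Nat.one_le_cast.mpr hne.card_pos
  -- Restricting to `S` deletes the diagonal entries outside `S` and keeps the others, so the error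
  -- cannot grow.
  have herr : errorWeight g (branchEffect U (fun r => V r * Q r) P)
      ≤ errorWeight g (branchEffect U V P) := by
    refine Finset.sum_le_sum fun ω _ => Finset.sum_le_sum fun μ _ => ?_
    have hbr : branchEffect U (fun r => V r * Q r) P ω
        = Matrix.diagonal d * branchEffect U V P ω * Matrix.diagonal d := by
      rw [branchEffect, hA, Matrix.conjTranspose_mul, hds, branchEffect]
      simp only [Matrix.mul_assoc]
    have h0 : 0 ≤ (branchEffect U V P ω μ μ).re :=
      (Complex.le_def.mp (branchEffect_posSemidef U V P ω).diag_nonneg).1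
    rw [hbr, Matrix.mul_diagonal, Matrix.diagonal_mul]
    simp only [hd]
    split_ifs
    · simp
    · simpa using h0
  obtain ⟨F, hF, hsmall⟩ := exists_productEffects_of_errorWeight_lt hU g (S := S) hη.le
    (min_le_right _ _) P (fun r => V r * Q r)
    (fun μ => by
      rw [htr, hgram, Matrix.diagonal_apply_eq]
      simp only [hd]
      split_ifs
      · simpa using hχ
      · simpa using zero_le_one.trans hχ)
    (fun μ hμ => by rw [hgram, Matrix.diagonal_apply_eq]; simp [hd, hμ])
    (by
      rw [htr]
      exact (herr.trans_lt hP).trans_le (le_mul_of_one_le_right hη.le hcard))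
  refine ⟨F, hF, fun μ ν hμν => (hsmall μ ν hμν).trans ?_⟩
  exact (Real.sqrt_le_sqrt (min_le_left _ _)).trans (Real.sqrt_sq hε.le).le

/-- If at least two vectors `⨂ r, ω μ r`, `μ ∈ S`, remain, then some party has a nontrivial
projective measurement which disturbs none of them. -/
theorem exists_localProjection {U : Matrix (∀ r, κ r) M ℂ}
    (hU : U * Uᴴ = 1) (hU' : Uᴴ * U = 1) (hdisc : AsymptoticallyDiscriminable U)
    {ω : M → ∀ r, κ r → ℂ} (hω : ∀ μ, U.col μ = productVec (ω μ))
    {S : Finset M} (hS : 2 ≤ S.card) {Q : ∀ r, Matrix (κ r) (κ r) ℂ}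
    (hQ : productOp Q * U = U * Matrix.diagonal fun μ => if μ ∈ S then (1 : ℂ) else 0) :
    ∃ (r : ι) (p : Matrix (κ r) (κ r) ℂ) (T : Finset M), pᴴ = p ∧ p * p = p ∧
      (∃ μ ∈ S, μ ∈ T) ∧ (∃ μ ∈ S, μ ∉ T) ∧
      ∀ μ ∈ S, p *ᵥ ω μ r = if μ ∈ T then ω μ r else 0 := by
  have hs : (2 : ℝ) ≤ S.card := by exact_mod_cast hS
  have hpos : (0 : ℝ) < 2 * S.card - 1 := by linarith
  -- This is `1 / (|S| - 1/2)`, strictly between `1/|S|` and, for `|S| ≥ 2`, both `1/(|S| - 1)` and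
  -- 1.
  set χ : ℝ := 2 / (2 * S.card - 1) with hχ
  have hχ0 : 0 < χ := div_pos two_pos hpos
  have hχ1 : χ < 1 := by rw [hχ, div_lt_one hpos]; linarith
  have hχs : 1 < χ * S.card := by rw [hχ, div_mul_eq_mul_div, one_lt_div hpos]; linarith
  have hχs' : χ * (S.card - 1) < 1 := by
    rw [hχ, div_mul_eq_mul_div, div_lt_one hpos]; linarith
  obtain ⟨F, ⟨hF, hFS, hFle, μ₀, hμ₀⟩, hdiag⟩ := exists_diagonal_productEffects_of_discriminable
    hU hU' hdisc (Finset.card_pos.mp (by omega)) hQ hχs.le hχ1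
  set e : M → ℂ := fun μ => inBasis U F μ μ with he
  have hsum : ∑ μ ∈ S, (e μ).re = 1 := by
    have h1 : (inBasis U F).trace.re = 1 := by
      rw [trace_inBasis hU, Finset.prod_eq_one fun r _ => (hF r).2, Complex.one_re]
    rw [Matrix.trace, Complex.re_sum] at h1
    rw [← h1]
    refine Finset.sum_subset (Finset.subset_univ S) fun μ _ hμ => ?_
    simp [he, hFS μ hμ]
  -- If one entry vanished, the remaining `|S| - 1` entries, each at most `χ`, could not sum to 1.
  have he0 : ∀ μ ∈ S, e μ ≠ 0 := fun μ hμ h => by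
    rw [← Finset.add_sum_erase _ _ hμ, h, Complex.zero_re, zero_add] at hsum
    have := Finset.sum_le_card_nsmul (S.erase μ) (fun ν => (e ν).re) χ fun ν _ => hFle ν
    rw [hsum, Finset.card_erase_of_mem hμ, nsmul_eq_mul, Nat.cast_sub (by omega), Nat.cast_one,
      mul_comm] at this
    linarith
  have hFU : productOp F * U = U * Matrix.diagonal e := by
    have : inBasis U F = Matrix.diagonal e := by
      ext μ ν
      by_cases h : μ = ν
      · subst h; rw [Matrix.diagonal_apply_eq]
      · rw [Matrix.diagonal_apply_ne _ h, hdiag μ ν h]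
    rw [← this, inBasis, ← Matrix.mul_assoc, ← Matrix.mul_assoc, hU, Matrix.one_mul]
  have heig : ∀ μ, productVec (fun r => F r *ᵥ ω μ r) = e μ • productVec (ω μ) := fun μ => by
    rw [← productOp_mulVec, ← hω]
    ext x
    have := congrFun (congrFun hFU x) μ
    rw [Matrix.mul_diagonal, mul_comm] at this
    exact this
  have hω0 : ∀ μ, productVec (ω μ) ≠ 0 := fun μ h => by
    have h1 := congrFun (congrFun hU' μ) μ
    rw [Matrix.one_apply_eq, Matrix.mul_apply] at h1
    rw [← hω] at h
    have h2 : ∀ x, U x μ = 0 := fun x => congrFun h x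
    simp [h2] at h1
  have hc : ∀ μ, ∃ c : ι → ℂ, μ ∈ S → (∀ r, F r *ᵥ ω μ r = c r • ω μ r) ∧ ∏ r, c r = e μ := by
    intro μ
    by_cases hμ : μ ∈ S
    · obtain ⟨c, hc⟩ := exists_eq_smul_of_productVec_eq_smul (he0 μ hμ) (hω0 μ) (heig μ)
      exact ⟨c, fun _ => hc⟩
    · exact ⟨0, fun h => absurd h hμ⟩
  choose c hc using hc
  have hμ₀S : μ₀ ∈ S := by
    by_contra h
    rw [hFS μ₀ h, Complex.zero_re] at hμ₀
    exact hχ0.ne hμ₀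
  -- If all local eigenvalues agreed with those of `μ₀`, every entry on `S` would be `χ`, with sum
  -- `χ * |S| > 1`.
  obtain ⟨r, μ₁, hμ₁, hne⟩ : ∃ r, ∃ μ ∈ S, c μ r ≠ c μ₀ r := by
    by_contra! hall
    have : ∀ μ ∈ S, (e μ).re = χ := fun μ hμ => by
      rw [← hμ₀, ← (hc μ hμ).2, Finset.prod_congr rfl fun r _ => hall r μ hμ, (hc μ₀ hμ₀S).2]
    rw [Finset.sum_congr rfl this, Finset.sum_const, nsmul_eq_mul, mul_comm] at hsum
    linarith
  obtain ⟨p, hp, hpp, hpv⟩ := exists_spectralProjection (hF r).1.isHermitian (c μ₀ r)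
  refine ⟨r, p, Finset.univ.filter fun μ => c μ r = c μ₀ r, hp, hpp, ⟨μ₀, hμ₀S, by simp⟩,
    ⟨μ₁, hμ₁, by simpa using hne⟩, fun μ hμ => ?_⟩
  rw [hpv _ _ ((hc μ hμ).1 r)]
  simp

/-- Strong induction on `|S|`. The operator `Q` records the projections made so far; it is absent
from the conclusion and serves to apply `exists_localProjection` to the vectors that remain. These
pass through each projection unchanged, so the protocols for the two parts of `S` can simply be
attached. -/
theorem exists_protocol_effect_mulVec_eq_zero [Nonempty M] {U : Matrix (∀ r, κ r) M ℂ}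
    (hU : U * Uᴴ = 1) (hU' : Uᴴ * U = 1) (hdisc : AsymptoticallyDiscriminable U)
    {ω : M → ∀ r, κ r → ℂ} (hω : ∀ μ, U.col μ = productVec (ω μ))
    {σ : ι → Type*} [∀ r, Fintype (σ r)] [∀ r, DecidableEq (σ r)]
    {V : ∀ r, Matrix (σ r) (κ r) ℂ} (hV : ∀ r, (V r)ᴴ * V r = 1) {Ω : Type} [DecidableEq Ω] (label : M → Ω) (S : Finset M) (Q : ∀ r, Matrix (κ r) (κ r) ℂ)
    (hQ : ∀ μ, productOp Q *ᵥ U.col μ = if μ ∈ S then U.col μ else 0) :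
    ∃ P : Protocol σ Ω, ∀ μ ∈ S, ∀ k, k ≠ label μ →
      P.effect k *ᵥ (productOp V *ᵥ U.col μ) = 0 := by
  induction hn : S.card using Nat.strong_induction_on generalizing S Q with
  | _ n ih =>
  subst hn
  by_cases hS : S.card ≤ 1
  · obtain ⟨μ₀, hμ₀⟩ := Finset.card_le_one_iff_subset_singleton.mp hS
    refine ⟨.output (label μ₀), fun μ hμ k hk => ?_⟩
    rw [Finset.mem_singleton.mp (hμ₀ hμ)] at hk
    rw [Protocol.effect, if_neg hk.symm, Matrix.zero_mulVec]
  have hQU : productOp Q * U = U * Matrix.diagonal fun μ => if μ ∈ S then (1 : ℂ) else 0 := by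
    ext x μ
    have := congrFun (hQ μ) x
    rw [Matrix.mul_diagonal]
    refine Eq.trans this ?_
    split_ifs <;> simp
  obtain ⟨r, p, T, hp, hpp, ⟨μ₁, hμ₁S, hμ₁⟩, ⟨μ₂, hμ₂S, hμ₂⟩, hpω⟩ :=
    exists_localProjection hU hU' hdisc hω (by omega) hQU
  have hp0 : ∀ μ ∈ S, localOp r p *ᵥ U.col μ = if μ ∈ T then U.col μ else 0 := by
    intro μ hμ
    have h := hpω μ hμ
    rw [hω]
    split_ifs at h ⊢ with hT
    · exact localOp_mulVec_eq_self h
    · exact localOp_mulVec_eq_zero h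
  have hp1 : ∀ μ ∈ S, localOp r (1 - p) *ᵥ U.col μ = if μ ∈ T then 0 else U.col μ := by
    intro μ hμ
    have h := hpω μ hμ
    rw [hω]
    split_ifs at h ⊢ with hT
    · exact localOp_mulVec_eq_zero (by rw [Matrix.sub_mulVec, Matrix.one_mulVec, h, sub_self])
    · exact localOp_mulVec_eq_self (by rw [Matrix.sub_mulVec, Matrix.one_mulVec, h, sub_zero])
  obtain ⟨P₀, hP₀⟩ := ih (S.filter (· ∈ T)).card
    (Finset.card_lt_card (Finset.filter_ssubset.mpr ⟨μ₂, hμ₂S, hμ₂⟩))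
    (S.filter (· ∈ T)) (update Q r (p * Q r)) (fun μ => by
      rw [← localOp_mul_productOp, ← Matrix.mulVec_mulVec, hQ]
      by_cases hμ : μ ∈ S
      · rw [if_pos hμ, hp0 μ hμ]; simp [hμ]
      · rw [if_neg hμ, Matrix.mulVec_zero]; simp [hμ]) rfl
  obtain ⟨P₁, hP₁⟩ := ih (S.filter (· ∉ T)).card
    (Finset.card_lt_card (Finset.filter_ssubset.mpr ⟨μ₁, hμ₁S, not_not.mpr hμ₁⟩))
    (S.filter (· ∉ T)) (update Q r ((1 - p) * Q r)) (fun μ => by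
      rw [← localOp_mul_productOp, ← Matrix.mulVec_mulVec, hQ]
      by_cases hμ : μ ∈ S
      · rw [if_pos hμ, hp1 μ hμ]; simp [hμ]
      · rw [if_neg hμ, Matrix.mulVec_zero]; simp [hμ]) rfl
  obtain ⟨K, hK, hK0, hK1⟩ := exists_twoOutcomeMeasurement (hV r) hp hpp
  refine ⟨.measure r 2 K hK ![P₀, P₁], fun μ hμ k hk => ?_⟩
  have h0 : localOp r (K 0) *ᵥ (productOp V *ᵥ U.col μ)
      = if μ ∈ T then productOp V *ᵥ U.col μ else 0 := by
    rw [Matrix.mulVec_mulVec, hK0, ← Matrix.mulVec_mulVec, hp0 μ hμ]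
    split_ifs <;> simp
  have h1 : localOp r (K 1) *ᵥ (productOp V *ᵥ U.col μ)
      = if μ ∈ T then 0 else productOp V *ᵥ U.col μ := by
    rw [Matrix.mulVec_mulVec, hK1, ← Matrix.mulVec_mulVec, hp1 μ hμ]
    split_ifs <;> simp
  rw [Protocol.effect, Fin.sum_univ_two, Matrix.add_mulVec, ← Matrix.mulVec_mulVec,
    ← Matrix.mulVec_mulVec, h0, ← Matrix.mulVec_mulVec, ← Matrix.mulVec_mulVec, h1]
  simp only [Matrix.cons_val_zero, Matrix.cons_val_one]
  by_cases hT : μ ∈ T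
  · rw [if_pos hT, if_pos hT, hP₀ μ (Finset.mem_filter.mpr ⟨hμ, hT⟩) k hk]
    simp only [Matrix.mulVec_zero, add_zero]
  · rw [if_neg hT, if_neg hT, hP₁ μ (Finset.mem_filter.mpr ⟨hμ, hT⟩) k hk]
    simp only [Matrix.mulVec_zero, add_zero]

end Discrimination

/-! ### Outcome probabilities in the given basis -/

section PureStates

variable {H : Type*} [Fintype H] [DecidableEq H] {M : Type*} [Fintype M] [DecidableEq M]

/-- The matrix whose columns are the vectors of an orthonormal basis. -/
def basisMatrix (ψ : OrthonormalBasis M ℂ (EuclideanSpace ℂ H)) : Matrix H M ℂ :=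
  Matrix.of fun x μ => ψ μ x

theorem basisMatrix_conjTranspose_mul_self (ψ : OrthonormalBasis M ℂ (EuclideanSpace ℂ H)) :
    (basisMatrix ψ)ᴴ * basisMatrix ψ = 1 := by
  ext μ ν
  have h := orthonormal_iff_ite.mp ψ.orthonormal μ ν
  rw [PiLp.inner_apply] at h
  rw [Matrix.mul_apply, Matrix.one_apply, ← h]
  refine Finset.sum_congr rfl fun x _ => ?_
  simp [basisMatrix, mul_comm]

theorem basisMatrix_mul_conjTranspose_self (ψ : OrthonormalBasis M ℂ (EuclideanSpace ℂ H)) :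
    basisMatrix ψ * (basisMatrix ψ)ᴴ = 1 := by
  have hcard : Fintype.card M = Fintype.card H := by
    rw [← finrank_euclideanSpace (𝕜 := ℂ) (ι := H), Module.finrank_eq_card_basis ψ.toBasis]
  exact (Matrix.mul_eq_one_comm_of_card_eq _ _ _ hcard).mp (basisMatrix_conjTranspose_mul_self ψ)

theorem POVM.prob_pureState {n : ℕ} (E : POVM H n)
    (ψ : OrthonormalBasis M ℂ (EuclideanSpace ℂ H)) (μ : M) (k : Fin n) :
    E.prob (pureState (ψ μ)) k = (((basisMatrix ψ)ᴴ * E.effect k * basisMatrix ψ) μ μ).re := by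
  rw [POVM.prob, pureState, Matrix.vecMulVec_mul, Matrix.trace_vecMulVec, Matrix.mul_apply,
    dotProduct]
  congr 1
  refine Finset.sum_congr rfl fun x _ => ?_
  rw [mul_comm]
  rfl

theorem POVM.prob_pureState_nonneg {n : ℕ} (E : POVM H n)
    (ψ : OrthonormalBasis M ℂ (EuclideanSpace ℂ H)) (μ : M) (k : Fin n) :
    0 ≤ E.prob (pureState (ψ μ)) k := by
  rw [E.prob_pureState]
  exact (Complex.le_def.mp ((E.posSemidef k).conjTranspose_mul_mul_same _).diag_nonneg).1

theorem POVM.sum_prob_pureState {n : ℕ} (E : POVM H n)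
    (ψ : OrthonormalBasis M ℂ (EuclideanSpace ℂ H)) (μ : M) :
    ∑ k, E.prob (pureState (ψ μ)) k = 1 := by
  simp only [E.prob_pureState]
  rw [← Complex.re_sum, ← Matrix.sum_apply, ← Matrix.sum_mul, ← Matrix.mul_sum, E.sum_eq_one,
    Matrix.mul_one, basisMatrix_conjTranspose_mul_self, Matrix.one_apply_eq, Complex.one_re]

/-- With the best guesses `g k`, the mean failure probability is the probability of a wrong
guess. -/
theorem exists_dmf_eq_sum [Nonempty M] {n : ℕ} (E : POVM H n)
    (ψ : OrthonormalBasis M ℂ (EuclideanSpace ℂ H)) {p : M → ℝ} (hp : ∑ μ, p μ = 1) :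
    ∃ g : Fin n → M, dmf p (fun μ => pureState (ψ μ)) E
      = ∑ k, ∑ μ ∈ Finset.univ.erase (g k), p μ * E.prob (pureState (ψ μ)) k := by
  choose g hg using fun k =>
    exists_eq_ciSup_of_finite (f := fun μ => p μ * E.prob (pureState (ψ μ)) k)
  refine ⟨g, ?_⟩
  have htot : ∑ k, ∑ μ, p μ * E.prob (pureState (ψ μ)) k = 1 := by
    rw [Finset.sum_comm, ← hp]
    refine Finset.sum_congr rfl fun μ _ => ?_
    rw [← Finset.mul_sum, E.sum_prob_pureState, mul_one]
  rw [dmf, ← htot, ← Finset.sum_sub_distrib]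
  refine Finset.sum_congr rfl fun k _ => ?_
  rw [← hg k, ← Finset.add_sum_erase _ _ (Finset.mem_univ (g k)), add_sub_cancel_left]

end PureStates

/-! ### From zero deviation to perfect discrimination -/

variable {ι : Type*} [Fintype ι] [DecidableEq ι] {κ : ι → Type*}
  [∀ r, Fintype (κ r)] [∀ r, DecidableEq (κ r)] {M : Type*} [Fintype M] [DecidableEq M]

/-- The priors drop out: the mean failure probability is at least the smallest prior times the
unweighted error. -/
theorem asymptoticallyDiscriminable_of_asymptoticDmf_eq_zero [Nonempty M]
    {ψ : OrthonormalBasis M ℂ (EuclideanSpace ℂ (∀ r, κ r))} {p : M → ℝ} (hp : ∀ μ, 0 < p μ)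
    (hp_sum : ∑ μ, p μ = 1) (hd : asymptoticDmf p (fun μ => pureState (ψ μ)) = 0) :
    AsymptoticallyDiscriminable (basisMatrix ψ) := by
  intro ε hε
  obtain ⟨μ₀, hμ₀⟩ := Finite.exists_min p
  -- The trivial one-outcome measurement shows that the infimum is over a nonempty set, so 0 is not
  -- merely the default value of `sInf`.
  have hne : {x : ℝ | ∃ (n : ℕ) (E : POVM (∀ r, κ r) n), IsFiniteLOCC E ∧
      x = dmf p (fun μ => pureState (ψ μ)) E}.Nonempty :=
    ⟨_, 1, _, Protocol.isFiniteLOCC_toPOVM (a := fun _ => 0) (.output 0), rfl⟩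
  rw [asymptoticDmf] at hd
  obtain ⟨_, ⟨n, E, ⟨a, P, hP⟩, rfl⟩, hlt⟩ :=
    exists_lt_of_csInf_lt hne (hd.trans_lt (mul_pos (hp μ₀) hε))
  obtain ⟨g, hg⟩ := exists_dmf_eq_sum E ψ hp_sum
  refine ⟨a, n, P, g, lt_of_mul_lt_mul_left (lt_of_le_of_lt ?_ hlt) (hp μ₀).le⟩
  rw [hg, errorWeight, Finset.mul_sum]
  refine Finset.sum_le_sum fun k _ => ?_
  rw [Finset.mul_sum]
  refine Finset.sum_le_sum fun μ _ => ?_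
  have : (branchEffect (basisMatrix ψ) (fun r => ancillaOp (κ r) (a r)) P k μ μ).re
      = E.prob (pureState (ψ μ)) k := by
    rw [E.prob_pureState, hP, branchEffect, ← adjoinAncilla_eq, Matrix.conjTranspose_mul]
    simp only [Matrix.mul_assoc]
  rw [this]
  exact mul_le_mul_of_nonneg_right (hμ₀ μ) (E.prob_pureState_nonneg ψ μ k)

end LOCC

end

theorem proposition2 {ι : Type*} [Fintype ι] [DecidableEq ι] {κ : ι → Type*}
    [∀ r, Fintype (κ r)] [∀ r, DecidableEq (κ r)] {M : Type*} [Fintype M]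
    (ψ : OrthonormalBasis M ℂ (EuclideanSpace ℂ (∀ r, κ r)))
    (hψ : ∀ μ, LOCC.IsProductVector (ψ μ))
    (p : M → ℝ) (hp : ∀ μ, 0 < p μ) (hp_sum : ∑ μ, p μ = 1)
    (hd : LOCC.asymptoticDmf p (fun μ => LOCC.pureState (ψ μ)) = 0) :
    ∃ (n : ℕ) (E : LOCC.POVM (∀ r, κ r) n),
      LOCC.IsFiniteLOCC E ∧ LOCC.PerfectlyDiscriminates E (fun μ => LOCC.pureState (ψ μ)) := by
  classical
  have : Nonempty M := by
    by_contra h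
    rw [not_nonempty_iff] at h
    simp at hp_sum
  choose ω hω using hψ
  set U := LOCC.basisMatrix ψ with hU
  let label := Fintype.equivFin M
  obtain ⟨P, hP⟩ := LOCC.exists_protocol_effect_mulVec_eq_zero
    (LOCC.basisMatrix_mul_conjTranspose_self ψ) (LOCC.basisMatrix_conjTranspose_mul_self ψ)
    (LOCC.asymptoticallyDiscriminable_of_asymptoticDmf_eq_zero hp hp_sum hd)
    (ω := ω) (fun μ => funext fun x => hω μ x)
    -- Ancillas of dimension `0 + 1 = 1`: the perfect protocol needs none.
    (V := fun r => LOCC.ancillaOp (κ r) ((fun _ => 0 : ι → ℕ) r))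
    (fun r => LOCC.ancillaOp_conjTranspose_mul_self (κ r) _)
    label Finset.univ (fun _ => 1)
    (fun μ => by rw [LOCC.productOp_one, Matrix.one_mulVec, if_pos (Finset.mem_univ μ)])
  refine ⟨Fintype.card M, P.toPOVM, P.isFiniteLOCC_toPOVM, label.symm, fun k μ hμ => ?_⟩
  have hk : k ≠ label μ := fun h => hμ (by rw [h, Equiv.symm_apply_apply])
  have hzero := hP μ (Finset.mem_univ μ) k hk
  have hcol : (LOCC.adjoinAncilla κ (fun _ => 0))ᴴ *ᵥ (P.effect k *ᵥ
      (LOCC.adjoinAncilla κ (fun _ => 0) *ᵥ U.col μ)) = 0 := by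
    rw [LOCC.adjoinAncilla_eq, hzero, Matrix.mulVec_zero]
  rw [Matrix.mulVec_mulVec, Matrix.mulVec_mulVec] at hcol
  rw [LOCC.POVM.prob_pureState, Matrix.mul_assoc, Matrix.mul_apply]
  have hx : ∀ x, (P.toPOVM.effect k * U) x μ = 0 := fun x => congrFun hcol x
  simp [← hU, hx]
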